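/- Let $\theta\ge 1$ and $\mu>0$ be fixed real numbers, and for each $n\ge 1$ let $J_n\subset\{1,\dots,n\}$ be arbitrary. For a permutation $\sigma$ in the symmetric group $S_n$, let $k_j(\sigma)$ be the number of its cycles of length $j$ (fixed points are cycles of length $1$), let $w(\sigma)=\sum_{j\le n}k_j(\sigma)$ be the number of all its cycles and $w(\sigma,J_n)=\sum_{j\in J_n}k_j(\sigma)$ the number of its cycles with lengths in $J_n$. Let $\nu_n$ be the Ewens probability measure on $S_n$ with parameter $\theta$, $$\nu_n(A)=\frac{1}{\theta(\theta+1)\cdots(\theta+n-1)}\sum_{\sigma\in A}\theta^{w(\sigma)},\qquad A\subset S_n .$$ Then the distribution functions $V_n(x)=\nu_n\big(w(\sigma,J_n)<x\big)$ converge weakly, as $n\to\infty$, to the distribution function $\Pi_\mu(x)$ of the Poisson law with parameter $\mu$ (that is, $V_n(x)\to\Pi_\mu(x)$ at every continuity point $x$ of $\Pi_\mu$) if and only if there exists a sequence $r=r(n)$ of non-negative integers with $r(n)=o(n)$ such that, as $n\to\infty$, $$\sum_{j\in J_n,\ j\le r}\frac{\theta}{j}\to\mu\qquad\text{and}\qquad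 \sum_{j\in J_n,\ r<j<n}\frac1j\Big(1-\frac jn\Big)^{\theta-1}\to 0 .$$ -/

import Mathlib

open Filter Topology Asymptotics
open scoped NNReal

namespace Ewens

/-- `k_j(σ)`: the number of cycles of length `j` of the permutation `σ` of an `n`-element set.
Fixed points count as cycles of length one. -/
def cycleCount {n : ℕ} (σ : Equiv.Perm (Fin n)) (j : ℕ) : ℕ :=
  σ.partition.parts.count j

/-- `w(σ)`: the total number of cycles of `σ`, fixed points included. -/
def numCycles {n : ℕ} (σ : Equiv.Perm (Fin n)) : ℕ :=
  Multiset.card σ.partition.parts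

/-- `w(σ, J)`: the number of cycles of `σ` whose lengths belong to `J`. -/
def numCyclesIn {n : ℕ} (σ : Equiv.Perm (Fin n)) (J : Finset ℕ) : ℕ :=
  ∑ j ∈ J, cycleCount σ j

open Classical in
/-- The Ewens probability `ν_{n,θ}(A) = (1 / θ^{(n)}) ∑_{σ ∈ A} θ ^ w(σ)` of a set `A` of
permutations, where `θ^{(n)} = θ (θ + 1) ⋯ (θ + n - 1)`. -/
noncomputable def ewensProb (θ : ℝ) (n : ℕ) (A : Set (Equiv.Perm (Fin n))) : ℝ :=
  1 / (ascPochhammer ℝ n).eval θ * ∑ σ : Equiv.Perm (Fin n) with σ ∈ A, θ ^ numCycles σ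

/-- The distribution function `V_n(x) = ν_{n,θ}(w(σ, J) < x)`. -/
noncomputable def cycleCDF (θ : ℝ) (n : ℕ) (J : Finset ℕ) (x : ℝ) : ℝ :=
  ewensProb θ n {σ | (numCyclesIn σ J : ℝ) < x}

/-- The distribution function `x ↦ P(Y < x)` of a Poisson random variable `Y` with
parameter `μ`. -/
noncomputable def poissonCDF (μ : ℝ≥0) (x : ℝ) : ℝ :=
  (ProbabilityTheory.poissonMeasure μ).real {k : ℕ | (k : ℝ) < x}

/-- Weak convergence of distribution functions: pointwise convergence at every continuity point
of the limit distribution function. -/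
def WeakConv (F : ℕ → ℝ → ℝ) (G : ℝ → ℝ) : Prop :=
  ∀ x : ℝ, ContinuousAt G x → Tendsto (fun n => F n x) atTop (𝓝 (G x))

end Ewens

namespace Ewens

/-! Removing a cycle of length j leaves an Ewens permutation of n - j points. Hence the factorial
moments f_k(n) of the number of cycles with lengths in a fixed set J satisfy f_{k+1}(n) = Σ_{j ∈ J}
λ_j(n) f_k(n - j), where λ_j(n) is the mean number of j-cycles (`normMoment_succ`). For θ ≥ 1 each
λ_j(n) increases with n, so f_k(n) ≤ a ^ k with a = f_1(n) (`normMoment_le_pow`).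

This domination makes Poisson convergence equivalent to f_k → μ ^ k for every k
(`tendsto_cycleMass_iff`). That the means stay bounded when the laws converge follows from f_2 ≤ a ^
2: the variance is at most the mean, while the mass at 0 tends to exp(-μ) > 0.

Sufficiency of the condition: removing k cycles of length at most r = o(n) barely changes n, so f_k
is at least (1 + o(1)) (Σ_{j ≤ r} θ/j) ^ k. The upper bound a ^ k has the same limit, since λ_j(n)
is comparable with (θ/j)(1 - j/n) ^ (θ - 1) for j < n.

Necessity: k cycles longer than n/k do not fit into n points, so their mean number b satisfies b ^ k
≤ a ^ k - f_k (`normMoment_le_pow_sub_pow`). Both terms on the right tend to μ ^ k, so b → 0 for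
each fixed k, and a diagonal choice of k = k(n) → ∞ yields r. -/

/-! ### Cycle types and the sizes of conjugacy classes -/

open Finset in
/-- The multisets of parts of the partitions of `n`. -/
def partitionMultisets (n : ℕ) : Finset (Multiset ℕ) :=
  (univ : Finset n.Partition).image Nat.Partition.parts

theorem mem_partitionMultisets {n : ℕ} {m : Multiset ℕ} :
    m ∈ partitionMultisets n ↔ (∀ i ∈ m, 0 < i) ∧ m.sum = n := by
  simp only [partitionMultisets, Finset.mem_image, Finset.mem_univ, true_and]
  constructor
  · rintro ⟨q, rfl⟩
    exact ⟨fun i hi => q.parts_pos hi, q.parts_sum⟩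
  · rintro ⟨h1, h2⟩
    exact ⟨⟨m, fun {i} hi => h1 i hi, h2⟩, rfl⟩

theorem parts_mem_partitionMultisets {n : ℕ} (σ : Equiv.Perm (Fin n)) :
    σ.partition.parts ∈ partitionMultisets n :=
  mem_partitionMultisets.2 ⟨fun _ hi => σ.partition.parts_pos hi,
    σ.partition.parts_sum.trans (Fintype.card_fin n)⟩

/-- The order of the centralizer of a permutation whose cycle lengths are the elements of `m`. -/
def centralizerOrder (m : Multiset ℕ) : ℕ :=
  m.prod * ∏ i ∈ m.toFinset, (m.count i).factorial

theorem prod_factorial_count_of_subset {m : Multiset ℕ} {T : Finset ℕ} (h : m.toFinset ⊆ T) :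
    ∏ i ∈ m.toFinset, (m.count i).factorial = ∏ i ∈ T, (m.count i).factorial := by
  refine Finset.prod_subset h fun i _ hi => ?_
  rw [Multiset.count_eq_zero_of_notMem (by simpa using hi), Nat.factorial_zero]

theorem centralizerOrder_pos {m : Multiset ℕ} (h : ∀ i ∈ m, 0 < i) : 0 < centralizerOrder m :=
  Nat.mul_pos (Multiset.prod_pos h) (Finset.prod_pos fun _ _ => Nat.factorial_pos _)

theorem centralizerOrder_cons (j : ℕ) (m : Multiset ℕ) :
    centralizerOrder (j ::ₘ m) = j * (m.count j + 1) * centralizerOrder m := by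
  have h : ∏ i ∈ insert j m.toFinset, ((j ::ₘ m).count i).factorial =
      (m.count j + 1) * ∏ i ∈ insert j m.toFinset, (m.count i).factorial := by
    rw [← Finset.mul_prod_erase _ _ (Finset.mem_insert_self j _),
      ← Finset.mul_prod_erase _ (fun i => (m.count i).factorial) (Finset.mem_insert_self j _),
      Multiset.count_cons_self, Nat.factorial_succ, mul_assoc]
    congr 2
    refine Finset.prod_congr rfl fun i hi => ?_
    rw [Multiset.count_cons_of_ne (Finset.ne_of_mem_erase hi)]
  rw [centralizerOrder, Multiset.prod_cons, Multiset.toFinset_cons, h, centralizerOrder,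
    prod_factorial_count_of_subset (Finset.subset_insert j m.toFinset)]
  ring

theorem centralizerOrder_add_replicate (c : ℕ) {m : Multiset ℕ} (h : ∀ i ∈ m, 2 ≤ i) :
    centralizerOrder (m + Multiset.replicate c 1) = c.factorial * centralizerOrder m := by
  induction c with
  | zero => simp
  | succ c ih =>
    have h1 : m.count 1 = 0 :=
      Multiset.count_eq_zero_of_notMem fun h1 => by have := h 1 h1; omega
    rw [Multiset.replicate_succ, Multiset.add_cons, centralizerOrder_cons, ih]
    simp [h1, Nat.factorial_succ]
    ring

theorem parts_partition_eq_iff {n : ℕ} (σ : Equiv.Perm (Fin n)) {m : Multiset ℕ} {c : ℕ}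
    (h : ∀ i ∈ m, 2 ≤ i) (hn : m.sum + c = n) :
    σ.partition.parts = m + Multiset.replicate c 1 ↔ σ.cycleType = m := by
  constructor
  · intro hσ
    rw [← Equiv.Perm.filter_parts_partition_eq_cycleType, hσ, Multiset.filter_add,
      Multiset.filter_eq_self.2 h, Multiset.filter_eq_nil.2, add_zero]
    intro a ha
    rw [Multiset.eq_of_mem_replicate ha]
    norm_num
  · intro hσ
    rw [Equiv.Perm.parts_partition, ← Equiv.Perm.sum_cycleType, hσ, Fintype.card_fin]
    congr 2
    omega

/-- Cauchy's formula. Since `cycleType` omits fixed points, m is split into its parts of size at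
least 2 and c ones; the ones account for the factor c!. -/
theorem card_parts_eq_mul {n : ℕ} {m : Multiset ℕ} (hm : m ∈ partitionMultisets n) :
    (Finset.univ.filter fun σ : Equiv.Perm (Fin n) => σ.partition.parts = m).card *
      centralizerOrder m = n.factorial := by
  obtain ⟨hpos, hsum⟩ := mem_partitionMultisets.1 hm
  obtain ⟨m', c, h2, rfl⟩ : ∃ (m' : Multiset ℕ) (c : ℕ), (∀ i ∈ m', 2 ≤ i) ∧
      m = m' + Multiset.replicate c 1 := by
    refine ⟨m.filter (2 ≤ ·), m.count 1, fun i hi => (Multiset.mem_filter.1 hi).2, ?_⟩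
    rw [← Multiset.filter_eq']
    conv_lhs => rw [← Multiset.filter_add_not (2 ≤ ·) m]
    congr 1
    refine Multiset.filter_congr fun i hi => ?_
    have := hpos i hi
    omega
  rw [Multiset.sum_add, Multiset.sum_replicate, smul_eq_mul, mul_one] at hsum
  simp_rw [parts_partition_eq_iff _ h2 hsum]
  have key := Equiv.Perm.card_of_cycleType_mul_eq (Fin n) m'
  rw [if_pos ⟨by rw [Fintype.card_fin]; omega, h2⟩, Fintype.card_fin,
    show n - m'.sum = c by omega] at key
  rw [centralizerOrder_add_replicate c h2, centralizerOrder, ← key]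
  congr 1
  ring

/-! ### Weighted sums over partitions -/

/-- The total weight, divided by `n!`, which the Ewens measure gives to the permutations of `n`
elements with multiset of cycle lengths `m`. -/
noncomputable def partitionWeight (θ : ℝ) (m : Multiset ℕ) : ℝ :=
  θ ^ Multiset.card m / centralizerOrder m

theorem partitionWeight_nonneg {θ : ℝ} (hθ : 0 ≤ θ) (m : Multiset ℕ) : 0 ≤ partitionWeight θ m := by
  unfold partitionWeight; positivity

theorem sum_perm_eq_sum_partitionMultisets (θ : ℝ) (n : ℕ) (F : Multiset ℕ → ℝ) :
    ∑ σ : Equiv.Perm (Fin n), θ ^ numCycles σ * F σ.partition.parts =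
      n.factorial * ∑ m ∈ partitionMultisets n, partitionWeight θ m * F m := by
  rw [← Finset.sum_fiberwise_of_maps_to (t := partitionMultisets n)
    (g := fun σ : Equiv.Perm (Fin n) => σ.partition.parts)
    (fun σ _ => parts_mem_partitionMultisets σ), Finset.mul_sum]
  refine Finset.sum_congr rfl fun m hm => ?_
  rw [Finset.sum_congr rfl (g := fun _ => θ ^ Multiset.card m * F m), Finset.sum_const,
    nsmul_eq_mul, partitionWeight, ← card_parts_eq_mul hm]
  · have : (centralizerOrder m : ℝ) ≠ 0 :=
      Nat.cast_ne_zero.2 (centralizerOrder_pos (mem_partitionMultisets.1 hm).1).ne'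
    push_cast
    field_simp
  · intro σ hσ
    rw [numCycles, (Finset.mem_filter.1 hσ).2]

theorem partitionWeight_cons_mul_count (θ : ℝ) {j : ℕ} (hj : 0 < j) {m : Multiset ℕ}
    (hm : ∀ i ∈ m, 0 < i) :
    partitionWeight θ (j ::ₘ m) * ((j ::ₘ m).count j : ℝ) = θ / j * partitionWeight θ m := by
  have h1 : (centralizerOrder m : ℝ) ≠ 0 := Nat.cast_ne_zero.2 (centralizerOrder_pos hm).ne'
  have h2 : (j : ℝ) ≠ 0 := Nat.cast_ne_zero.2 hj.ne'
  have h3 : (m.count j : ℝ) + 1 ≠ 0 := by positivity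
  rw [partitionWeight, partitionWeight, centralizerOrder_cons, Multiset.count_cons_self,
    Multiset.card_cons]
  push_cast
  field_simp
  ring

/-- Weighting by the multiplicity of j cancels the factor it contributes to the centralizer order,
so deleting one part j is a bijection onto the partitions of n - j that costs only θ / j. Every
moment recursion below comes from this. -/
theorem sum_partitionWeight_mul_count (θ : ℝ) {n j : ℕ} (hj : 0 < j) (F : Multiset ℕ → ℝ) :
    ∑ m ∈ partitionMultisets n, partitionWeight θ m * (m.count j : ℝ) * F m =
      if j ≤ n then θ / j * ∑ m ∈ partitionMultisets (n - j), partitionWeight θ m * F (j ::ₘ m)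
      else 0 := by
  rw [← Finset.sum_filter_of_ne (p := fun m => j ∈ m)]
  swap
  · intro m _ h
    by_contra hjm
    simp [Multiset.count_eq_zero_of_notMem hjm] at h
  split_ifs with hjn
  · rw [Finset.mul_sum]
    symm
    refine Finset.sum_bij (fun m _ => j ::ₘ m) ?_ ?_ ?_ ?_
    · intro m hm
      obtain ⟨h1, h2⟩ := mem_partitionMultisets.1 hm
      refine Finset.mem_filter.2 ⟨mem_partitionMultisets.2 ⟨?_, ?_⟩, Multiset.mem_cons_self _ _⟩
      · intro i hi
        rcases Multiset.mem_cons.1 hi with rfl | hi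
        exacts [hj, h1 i hi]
      · rw [Multiset.sum_cons, h2]; omega
    · intro m _ m' _ h
      exact (Multiset.cons_inj_right j).1 h
    · intro m hm
      obtain ⟨hm, hjm⟩ := Finset.mem_filter.1 hm
      obtain ⟨h1, h2⟩ := mem_partitionMultisets.1 hm
      refine ⟨m.erase j, mem_partitionMultisets.2 ⟨fun i hi => h1 i (Multiset.mem_of_mem_erase hi),
        ?_⟩, Multiset.cons_erase hjm⟩
      rw [← Multiset.cons_erase hjm, Multiset.sum_cons] at h2
      omega
    · intro m hm
      rw [partitionWeight_cons_mul_count θ hj (mem_partitionMultisets.1 hm).1]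
      ring
  · refine Finset.sum_eq_zero fun m hm => ?_
    obtain ⟨hm, hjm⟩ := Finset.mem_filter.1 hm
    have := Multiset.le_sum_of_mem hjm
    rw [(mem_partitionMultisets.1 hm).2] at this
    exact absurd this hjn

/-- The coefficient of `z ^ n` in `(1 - z) ^ (-θ)`. -/
noncomputable def risingCoeff (θ : ℝ) (n : ℕ) : ℝ := (ascPochhammer ℝ n).eval θ / n.factorial

theorem risingCoeff_zero (θ : ℝ) : risingCoeff θ 0 = 1 := by simp [risingCoeff]

theorem risingCoeff_succ (θ : ℝ) (n : ℕ) :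
    (n + 1 : ℝ) * risingCoeff θ (n + 1) = (n + θ) * risingCoeff θ n := by
  have : (n.factorial : ℝ) ≠ 0 := by positivity
  rw [risingCoeff, risingCoeff, ascPochhammer_succ_eval, Nat.factorial_succ]
  push_cast
  field_simp
  ring

theorem mul_risingCoeff_eq_sum (θ : ℝ) (n : ℕ) :
    n * risingCoeff θ n = θ * ∑ i ∈ Finset.range n, risingCoeff θ i := by
  induction n with
  | zero => simp
  | succ n ih =>
    rw [Finset.sum_range_succ, mul_add, ← ih, Nat.cast_succ, risingCoeff_succ]
    ring

theorem sum_Icc_mul_count {n : ℕ} {m : Multiset ℕ} (hm : m ∈ partitionMultisets n) :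
    ∑ j ∈ Finset.Icc 1 n, j * m.count j = n := by
  obtain ⟨h1, h2⟩ := mem_partitionMultisets.1 hm
  conv_rhs => rw [← h2, Finset.sum_multiset_count]
  symm
  simp_rw [smul_eq_mul, mul_comm (m.count _)]
  refine Finset.sum_subset (fun i hi => ?_) fun i _ hi => ?_
  · have hi := Multiset.mem_toFinset.1 hi
    exact Finset.mem_Icc.2 ⟨h1 i hi, h2 ▸ Multiset.le_sum_of_mem hi⟩
  · rw [Multiset.count_eq_zero_of_notMem (by simpa using hi), mul_zero]

/-- Counting points by the length of their cycle, Σ j k_j = n, gives n p_n = θ (p_0 + ⋯ + p_{n-1})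
for the total weights p_n, the recursion of the coefficients of (1 - z) ^ (-θ). -/
theorem sum_partitionWeight (θ : ℝ) (n : ℕ) :
    ∑ m ∈ partitionMultisets n, partitionWeight θ m = risingCoeff θ n := by
  induction n using Nat.strong_induction_on with
  | _ n ih =>
  rcases Nat.eq_zero_or_pos n with rfl | hn
  · have : partitionMultisets 0 = {0} := by
      ext m
      rw [mem_partitionMultisets, Finset.mem_singleton]
      constructor
      · rintro ⟨h1, h2⟩
        refine Multiset.eq_zero_of_forall_notMem fun i hi => ?_
        have := h1 i hi
        have := Multiset.le_sum_of_mem hi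
        omega
      · rintro rfl
        simp
    simp [this, risingCoeff_zero, partitionWeight, centralizerOrder]
  · have hn' : (n : ℝ) ≠ 0 := by positivity
    refine mul_left_cancel₀ hn' ?_
    rw [mul_risingCoeff_eq_sum, Finset.mul_sum]
    calc ∑ m ∈ partitionMultisets n, (n : ℝ) * partitionWeight θ m
        = ∑ m ∈ partitionMultisets n, ∑ j ∈ Finset.Icc 1 n,
            (j : ℝ) * (partitionWeight θ m * (m.count j : ℝ) * 1) := by
          refine Finset.sum_congr rfl fun m hm => ?_
          conv_lhs => rw [← sum_Icc_mul_count hm]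
          rw [Nat.cast_sum, Finset.sum_mul]
          refine Finset.sum_congr rfl fun j _ => ?_
          push_cast
          ring
      _ = ∑ j ∈ Finset.Icc 1 n, θ * risingCoeff θ (n - j) := by
          rw [Finset.sum_comm]
          refine Finset.sum_congr rfl fun j hj => ?_
          obtain ⟨hj1, hj2⟩ := Finset.mem_Icc.1 hj
          rw [← Finset.mul_sum, sum_partitionWeight_mul_count θ hj1 (fun _ => 1), if_pos hj2]
          simp_rw [mul_one]
          rw [ih _ (by omega)]
          have : (j : ℝ) ≠ 0 := by positivity
          field_simp
      _ = θ * ∑ i ∈ Finset.range n, risingCoeff θ i := by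
          rw [← Finset.mul_sum, ← Finset.sum_range_reflect]
          congr 1
          refine Finset.sum_bij' (fun j _ => j - 1) (fun i _ => i + 1) ?_ ?_ ?_ ?_ ?_
          · intro j hj; simp at hj ⊢; omega
          · intro j hj; simp at hj ⊢; omega
          · intro j hj; simp at hj ⊢; omega
          · intro j hj; simp at hj ⊢
          · intro j hj
            simp at hj ⊢
            congr 1
            omega

/-! ### Factorial moments and point masses -/

/-- The number of elements of `m` which lie in `J`, with multiplicity. -/
def countIn (J : Finset ℕ) (m : Multiset ℕ) : ℕ := ∑ j ∈ J, m.count j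

theorem countIn_cons {J : Finset ℕ} {j : ℕ} (hj : j ∈ J) (m : Multiset ℕ) :
    countIn J (j ::ₘ m) = countIn J m + 1 := by
  simp [countIn, Multiset.count_cons, Finset.sum_add_distrib, hj]

/-- The `k`-th factorial moment of the number of cycles with lengths in `J`, before
normalization. -/
noncomputable def factorialMoment (θ : ℝ) (J : Finset ℕ) (n k : ℕ) : ℝ :=
  ∑ m ∈ partitionMultisets n, partitionWeight θ m * ((countIn J m).descFactorial k : ℝ)

theorem factorialMoment_zero (θ : ℝ) (J : Finset ℕ) (n : ℕ) :
    factorialMoment θ J n 0 = risingCoeff θ n := by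
  simp [factorialMoment, sum_partitionWeight]

/-- Write (w)_{k+1} = w (w - 1)_k, expand w = Σ_{j ∈ J} k_j, and delete one cycle of length j from
each term; this lowers w by exactly one. -/
theorem factorialMoment_succ (θ : ℝ) {J : Finset ℕ} (hJ : ∀ j ∈ J, 0 < j) (n k : ℕ) :
    factorialMoment θ J n (k + 1) =
      ∑ j ∈ J, if j ≤ n then θ / j * factorialMoment θ J (n - j) k else 0 := by
  calc factorialMoment θ J n (k + 1)
      = ∑ m ∈ partitionMultisets n, ∑ j ∈ J, partitionWeight θ m * (m.count j : ℝ) *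
          ((countIn J m - 1).descFactorial k : ℝ) := by
        refine Finset.sum_congr rfl fun m _ => ?_
        rw [← Finset.sum_mul, ← Finset.mul_sum, ← Nat.cast_sum, mul_assoc, ← Nat.cast_mul]
        congr 2
        change _ = countIn J m * _
        cases countIn J m with
        | zero => simp
        | succ w => rw [Nat.succ_descFactorial_succ, Nat.add_sub_cancel]
    _ = _ := by
        rw [Finset.sum_comm]
        refine Finset.sum_congr rfl fun j hj => ?_
        rw [sum_partitionWeight_mul_count θ (hJ j hj)
          (fun m => ((countIn J m - 1).descFactorial k : ℝ))]
        simp_rw [countIn_cons hj, Nat.add_sub_cancel]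
        rfl

/-- The Ewens probability that exactly `l` cycles have lengths in `J`. -/
noncomputable def cycleMass (θ : ℝ) (J : Finset ℕ) (n l : ℕ) : ℝ :=
  (∑ m ∈ partitionMultisets n with countIn J m = l, partitionWeight θ m) / risingCoeff θ n

theorem countIn_le {J : Finset ℕ} {n : ℕ} {m : Multiset ℕ} (hm : m ∈ partitionMultisets n) :
    countIn J m ≤ n := by
  obtain ⟨h1, h2⟩ := mem_partitionMultisets.1 hm
  calc countIn J m ≤ ∑ j ∈ J ∪ m.toFinset, m.count j :=
        Finset.sum_le_sum_of_subset Finset.subset_union_left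
    _ = Multiset.card m := by
        rw [Multiset.sum_count_eq_card]
        intro a ha
        exact Finset.mem_union_right _ (Multiset.mem_toFinset.2 ha)
    _ ≤ m.sum := by
        have := Multiset.card_nsmul_le_sum (s := m) (a := 1) fun i hi => h1 i hi
        simpa using this
    _ = n := h2

theorem sum_mul_cycleMass (θ : ℝ) (J : Finset ℕ) (n : ℕ) (g : ℕ → ℝ) :
    ∑ l ∈ Finset.range (n + 1), g l * cycleMass θ J n l =
      (∑ m ∈ partitionMultisets n, partitionWeight θ m * g (countIn J m)) / risingCoeff θ n := by
  rw [← Finset.sum_fiberwise_of_maps_to (t := Finset.range (n + 1)) (g := countIn J)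
    (fun m hm => Finset.mem_range.2 (Nat.lt_succ_of_le (countIn_le hm))), Finset.sum_div]
  refine Finset.sum_congr rfl fun l _ => ?_
  rw [cycleMass, mul_div_assoc', Finset.mul_sum]
  congr 1
  refine Finset.sum_congr rfl fun m hm => ?_
  rw [(Finset.mem_filter.1 hm).2, mul_comm]

theorem cycleMass_eq_zero {θ : ℝ} {J : Finset ℕ} {n l : ℕ} (h : n < l) : cycleMass θ J n l = 0 := by
  rw [cycleMass, Finset.filter_false_of_mem, Finset.sum_empty, zero_div]
  intro m hm
  have := countIn_le (J := J) hm
  omega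

theorem cycleCDF_eq_sum (θ : ℝ) (J : Finset ℕ) (n : ℕ) (x : ℝ) :
    cycleCDF θ n J x = ∑ l ∈ Finset.range ⌈x⌉₊, cycleMass θ J n l := by
  classical
  have hlt : ∀ l : ℕ, l < ⌈x⌉₊ ↔ (l : ℝ) < x := fun l => Nat.lt_ceil
  have h1 : cycleCDF θ n J x = (∑ m ∈ partitionMultisets n, partitionWeight θ m *
      (if (countIn J m : ℝ) < x then 1 else 0)) / risingCoeff θ n := by
    have := sum_perm_eq_sum_partitionMultisets θ n
      (fun m => if (countIn J m : ℝ) < x then 1 else 0)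
    rw [risingCoeff, div_div_eq_mul_div, mul_comm _ (n.factorial : ℝ), ← this, cycleCDF, ewensProb,
      Finset.sum_filter, one_div_mul_eq_div]
    congr 1
    refine Finset.sum_congr rfl fun σ _ => ?_
    rw [mul_ite, mul_one, mul_zero]
    rfl
  rw [h1, ← sum_mul_cycleMass θ J n fun l => if (l : ℝ) < x then 1 else 0]
  simp_rw [ite_mul, one_mul, zero_mul, ← hlt]
  rw [← Finset.sum_filter]
  refine Finset.sum_subset_zero_on_sdiff ?_ ?_ fun _ _ => rfl
  · intro l hl
    simpa using (Finset.mem_filter.1 hl).2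
  · intro l hl
    obtain ⟨h1, h2⟩ := Finset.mem_sdiff.1 hl
    refine cycleMass_eq_zero (not_le.1 fun h3 => h2 (Finset.mem_filter.2 ?_))
    exact ⟨Finset.mem_range.2 (Nat.lt_succ_of_le h3), Finset.mem_range.1 h1⟩

theorem sum_descFactorial_mul_cycleMass (θ : ℝ) (J : Finset ℕ) (n k : ℕ) :
    ∑ l ∈ Finset.range (n + 1), (l.descFactorial k : ℝ) * cycleMass θ J n l =
      factorialMoment θ J n k / risingCoeff θ n :=
  sum_mul_cycleMass θ J n fun l => (l.descFactorial k : ℝ)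

/-! ### Monotonicity for θ ≥ 1 and moment bounds -/

theorem risingCoeff_pos {θ : ℝ} (hθ : 1 ≤ θ) (n : ℕ) : 0 < risingCoeff θ n :=
  div_pos (ascPochhammer_pos n θ (by linarith)) (by positivity)

theorem risingCoeff_monotone {θ : ℝ} (hθ : 1 ≤ θ) : Monotone (risingCoeff θ) := by
  refine monotone_nat_of_le_succ fun n => ?_
  have h1 := risingCoeff_succ θ n
  have h2 := (risingCoeff_pos hθ n).le
  have h3 : (0 : ℝ) < n + 1 := by positivity
  refine le_of_mul_le_mul_left ?_ h3
  rw [h1]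
  exact mul_le_mul_of_nonneg_right (by linarith) h2

/-- The growth factor (m + θ)/(m + 1) = 1 + (θ - 1)/(m + 1) is nonincreasing in m exactly when θ ≥
1, so the numerator grows at least as fast as the denominator. -/
theorem risingCoeff_ratio_monotone {θ : ℝ} (hθ : 1 ≤ θ) (j : ℕ) :
    Monotone fun m => risingCoeff θ m / risingCoeff θ (m + j) := by
  refine monotone_nat_of_le_succ fun m => ?_
  have p1 := risingCoeff_pos hθ m
  have p2 := risingCoeff_pos hθ (m + j)
  have h1 : risingCoeff θ (m + 1) = (m + θ) / (m + 1) * risingCoeff θ m := by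
    have := risingCoeff_succ θ m
    field_simp
    linarith
  have h2 : risingCoeff θ (m + 1 + j) = (m + j + θ) / (m + j + 1) * risingCoeff θ (m + j) := by
    have := risingCoeff_succ θ (m + j)
    rw [show m + 1 + j = m + j + 1 by ring]
    push_cast at this
    field_simp
    linarith
  have h3 : 1 ≤ (m + θ) / (m + 1) / ((m + j + θ) / (m + j + 1)) := by
    rw [div_div_div_eq, le_div_iff₀ (by positivity)]
    nlinarith [mul_nonneg (Nat.cast_nonneg (α := ℝ) j) (sub_nonneg.2 hθ)]
  rw [h1, h2, mul_div_mul_comm]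
  exact le_mul_of_one_le_left (div_pos p1 p2).le h3

/-- The expected number of cycles of length `j` under the Ewens measure on `n` elements. -/
noncomputable def lengthMean (θ : ℝ) (n j : ℕ) : ℝ :=
  if j ≤ n then θ / j * (risingCoeff θ (n - j) / risingCoeff θ n) else 0

theorem lengthMean_nonneg {θ : ℝ} (hθ : 1 ≤ θ) (n j : ℕ) : 0 ≤ lengthMean θ n j := by
  have h1 := (risingCoeff_pos hθ (n - j)).le
  have h2 := (risingCoeff_pos hθ n).le
  have h3 : 0 ≤ θ := by linarith
  unfold lengthMean
  split_ifs <;> positivity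

theorem lengthMean_mono {θ : ℝ} (hθ : 1 ≤ θ) (j : ℕ) : Monotone fun n => lengthMean θ n j := by
  intro m n hmn
  by_cases hj : j ≤ m
  · have h := risingCoeff_ratio_monotone hθ j (Nat.sub_le_sub_right hmn j)
    simp only [Nat.sub_add_cancel hj, Nat.sub_add_cancel (hj.trans hmn)] at h
    simp only [lengthMean, if_pos hj, if_pos (hj.trans hmn)]
    exact mul_le_mul_of_nonneg_left h (by positivity)
  · have : lengthMean θ m j = 0 := if_neg hj
    simpa only [this] using lengthMean_nonneg hθ n j

theorem lengthMean_le {θ : ℝ} (hθ : 1 ≤ θ) (n j : ℕ) : lengthMean θ n j ≤ θ / j := by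
  have h0 : 0 ≤ θ / j := by positivity
  unfold lengthMean
  split_ifs with h
  · exact mul_le_of_le_one_right h0
      (div_le_one_of_le₀ (risingCoeff_monotone hθ (Nat.sub_le n j)) (risingCoeff_pos hθ n).le)
  · exact h0

/-- The `k`-th factorial moment of the number of cycles with lengths in `J`. -/
noncomputable def normMoment (θ : ℝ) (J : Finset ℕ) (n k : ℕ) : ℝ :=
  factorialMoment θ J n k / risingCoeff θ n

theorem normMoment_zero {θ : ℝ} (hθ : 1 ≤ θ) (J : Finset ℕ) (n : ℕ) : normMoment θ J n 0 = 1 := by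
  rw [normMoment, factorialMoment_zero, div_self (risingCoeff_pos hθ n).ne']

theorem normMoment_succ {θ : ℝ} (hθ : 1 ≤ θ) {J : Finset ℕ} (hJ : ∀ j ∈ J, 0 < j) (n k : ℕ) :
    normMoment θ J n (k + 1) = ∑ j ∈ J, lengthMean θ n j * normMoment θ J (n - j) k := by
  rw [normMoment, factorialMoment_succ θ hJ, Finset.sum_div]
  refine Finset.sum_congr rfl fun j _ => ?_
  have h1 := (risingCoeff_pos hθ (n - j)).ne'
  have h2 := (risingCoeff_pos hθ n).ne'
  unfold lengthMean normMoment
  split_ifs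
  · field_simp
  · simp

theorem normMoment_one {θ : ℝ} (hθ : 1 ≤ θ) {J : Finset ℕ} (hJ : ∀ j ∈ J, 0 < j) (n : ℕ) :
    normMoment θ J n 1 = ∑ j ∈ J, lengthMean θ n j := by
  rw [normMoment_succ hθ hJ]
  simp [normMoment_zero hθ]

theorem normMoment_nonneg {θ : ℝ} (hθ : 1 ≤ θ) (J : Finset ℕ) (n k : ℕ) :
    0 ≤ normMoment θ J n k := by
  refine div_nonneg (Finset.sum_nonneg fun m _ => ?_) (risingCoeff_pos hθ n).le
  exact mul_nonneg (partitionWeight_nonneg (by linarith) m) (Nat.cast_nonneg _)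

theorem normMoment_le_pow {θ : ℝ} (hθ : 1 ≤ θ) {J : Finset ℕ} (hJ : ∀ j ∈ J, 0 < j) {n N : ℕ}
    (hn : n ≤ N) (k : ℕ) : normMoment θ J n k ≤ (∑ j ∈ J, lengthMean θ N j) ^ k := by
  induction k generalizing n with
  | zero => rw [normMoment_zero hθ, pow_zero]
  | succ k ih =>
    rw [normMoment_succ hθ hJ, pow_succ', Finset.sum_mul]
    exact Finset.sum_le_sum fun j _ => mul_le_mul (lengthMean_mono hθ j hn)
      (ih ((Nat.sub_le n j).trans hn)) (normMoment_nonneg hθ _ _ _) (lengthMean_nonneg hθ _ _)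

/-- The `k`-tuples of cycles longer than `r` do not fit into `n < k (r + 1)` elements. -/
theorem normMoment_le_pow_sub_pow {θ : ℝ} (hθ : 1 ≤ θ) {J : Finset ℕ} (hJ : ∀ j ∈ J, 0 < j) (r : ℕ)
    {n N k : ℕ} (hn : n ≤ N) (hk : n < k * (r + 1)) :
    normMoment θ J n k ≤ (∑ j ∈ J, lengthMean θ N j) ^ k -
      (∑ j ∈ J with r < j, lengthMean θ N j) ^ k := by
  induction k generalizing n with
  | zero => omega
  | succ k ih =>
    set a := ∑ j ∈ J, lengthMean θ N j with ha
    set b := ∑ j ∈ J with r < j, lengthMean θ N j with hb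
    -- A cycle with j > r leaves fewer than k (r + 1) points, so the induction hypothesis applies;
    -- for j ≤ r the bound a ^ k suffices. Summing gives a * a ^ k - b * b ^ k.
    have hstep : ∀ j ∈ J, lengthMean θ n j * normMoment θ J (n - j) k ≤
        lengthMean θ N j * a ^ k - (if r < j then lengthMean θ N j else 0) * b ^ k := by
      intro j _
      have h0 := lengthMean_nonneg hθ N j
      split_ifs with hj
      · rw [← mul_sub]
        by_cases hjn : j ≤ n
        · refine mul_le_mul (lengthMean_mono hθ j hn) (ih ((Nat.sub_le n j).trans hn) ?_)
            (normMoment_nonneg hθ _ _ _) h0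
          rw [Nat.succ_mul] at hk
          omega
        -- Lengths above n contribute nothing, and the right side is nonnegative because b ≤ a.
        · rw [lengthMean, if_neg hjn, zero_mul]
          refine mul_nonneg h0 (sub_nonneg.2 (pow_le_pow_left₀ ?_ ?_ k))
          · exact Finset.sum_nonneg fun j _ => lengthMean_nonneg hθ N j
          · exact Finset.sum_le_sum_of_subset_of_nonneg (Finset.filter_subset _ _)
              fun j _ _ => lengthMean_nonneg hθ N j
      · rw [zero_mul, sub_zero]
        exact mul_le_mul (lengthMean_mono hθ j hn)
          (normMoment_le_pow hθ hJ ((Nat.sub_le n j).trans hn) k) (normMoment_nonneg hθ _ _ _) h0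
    rw [normMoment_succ hθ hJ]
    refine (Finset.sum_le_sum hstep).trans_eq ?_
    rw [Finset.sum_sub_distrib, ← Finset.sum_mul, ← Finset.sum_mul, ← Finset.sum_filter, pow_succ',
      pow_succ']

/-- Keep only tuples of cycles of length at most r: they use at most k r points, and the
coefficients are monotone. -/
theorem le_factorialMoment {θ : ℝ} (hθ : 1 ≤ θ) {J : Finset ℕ} (hJ : ∀ j ∈ J, 0 < j) (r : ℕ)
    {n k : ℕ} (hk : k * r ≤ n) :
    risingCoeff θ (n - k * r) * (∑ j ∈ J with j ≤ r, θ / (j : ℝ)) ^ k ≤ factorialMoment θ J n k := by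
  induction k generalizing n with
  | zero => simp [factorialMoment_zero]
  | succ k ih =>
    rw [Nat.succ_mul] at hk ⊢
    have hS : 0 ≤ ∑ j ∈ J with j ≤ r, θ / (j : ℝ) := Finset.sum_nonneg fun j _ => by positivity
    have hM : ∀ i, 0 ≤ factorialMoment θ J i k := fun i => Finset.sum_nonneg fun m _ =>
      mul_nonneg (partitionWeight_nonneg (by linarith) m) (Nat.cast_nonneg _)
    rw [factorialMoment_succ θ hJ]
    calc _ = ∑ j ∈ J with j ≤ r, θ / (j : ℝ) *
          (risingCoeff θ (n - (k * r + r)) * (∑ j ∈ J with j ≤ r, θ / (j : ℝ)) ^ k) := by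
          rw [← Finset.sum_mul]; ring
      _ ≤ ∑ j ∈ J with j ≤ r, if j ≤ n then θ / j * factorialMoment θ J (n - j) k else 0 := by
          refine Finset.sum_le_sum fun j hj => ?_
          have hj := (Finset.mem_filter.1 hj).2
          rw [if_pos (by omega)]
          refine mul_le_mul_of_nonneg_left (le_trans ?_ (ih (n := n - j) (by omega))) (by positivity)
          exact mul_le_mul_of_nonneg_right (risingCoeff_monotone hθ (by omega)) (by positivity)
      _ ≤ _ := by
          refine Finset.sum_le_sum_of_subset_of_nonneg (Finset.filter_subset _ _) fun j _ _ => ?_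
          have := hM (n - j)
          split_ifs <;> positivity

/-! ### Asymptotics of the coefficients -/

/-- Euler's product for Γ(θ) carries one more factor, θ + n, than the rising factorial; hence the
correction n / (n + θ). -/
theorem risingCoeff_div_rpow_eq {θ : ℝ} (hθ : 1 ≤ θ) {n : ℕ} (hn : 0 < n) :
    risingCoeff θ n / (n : ℝ) ^ (θ - 1) = (Real.GammaSeq θ n)⁻¹ * (n / (n + θ)) := by
  have h1 : ∀ k : ℕ, (ascPochhammer ℝ k).eval θ = ∏ i ∈ Finset.range k, (θ + i) := by
    intro k
    induction k with
    | zero => simp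
    | succ k ih => rw [ascPochhammer_succ_eval, ih, Finset.prod_range_succ]
  have hn' : (0 : ℝ) < n := by exact_mod_cast hn
  have h2 : 0 < ∏ i ∈ Finset.range n, (θ + (i : ℝ)) :=
    Finset.prod_pos fun i _ => by positivity
  rw [risingCoeff, h1, Real.GammaSeq, Finset.prod_range_succ, Real.rpow_sub hn', Real.rpow_one]
  have h3 := Real.rpow_pos_of_pos hn' θ
  field_simp
  ring

theorem tendsto_risingCoeff_div_rpow {θ : ℝ} (hθ : 1 ≤ θ) :
    Tendsto (fun n : ℕ => risingCoeff θ n / (n : ℝ) ^ (θ - 1)) atTop (𝓝 (Real.Gamma θ)⁻¹) := by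
  have h1 := ((Real.GammaSeq_tendsto_Gamma θ).inv₀ (Real.Gamma_pos_of_pos (by linarith)).ne').mul
    (tendsto_natCast_div_add_atTop θ)
  rw [mul_one] at h1
  refine h1.congr' ?_
  filter_upwards [eventually_gt_atTop 0] with n hn
  exact (risingCoeff_div_rpow_eq hθ hn).symm

theorem exists_bounds_of_tendsto {u : ℕ → ℝ} {L : ℝ} (hu : ∀ n, 0 < n → 0 < u n)
    (h : Tendsto u atTop (𝓝 L)) (hL : 0 < L) :
    ∃ c C, 0 < c ∧ 0 < C ∧ ∀ n, 0 < n → c ≤ u n ∧ u n ≤ C := by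
  have key : ∀ {v : ℕ → ℝ} {M : ℝ}, Tendsto v atTop (𝓝 M) → ∃ C, 0 < C ∧ ∀ n, v n ≤ C := by
    intro v M hv
    obtain ⟨C, hC⟩ := hv.bddAbove_range
    exact ⟨max C 1, by positivity, fun n => le_max_of_le_left (hC ⟨n, rfl⟩)⟩
  obtain ⟨C, hC0, hC⟩ := key h
  obtain ⟨D, hD0, hD⟩ := key (h.inv₀ hL.ne')
  exact ⟨D⁻¹, C, inv_pos.2 hD0, hC0, fun n hn => ⟨inv_le_of_inv_le₀ (hu n hn) (hD n), hC n⟩⟩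

/-- The ratio of two coefficients is comparable with the power `(1 - j / n) ^ (θ - 1)`. -/
theorem exists_risingCoeff_ratio_bounds {θ : ℝ} (hθ : 1 ≤ θ) : ∃ K, 0 < K ∧ ∀ n j : ℕ, j < n →
    (1 - (j : ℝ) / n) ^ (θ - 1) ≤ K * (risingCoeff θ (n - j) / risingCoeff θ n) ∧
    risingCoeff θ (n - j) / risingCoeff θ n ≤ K * (1 - (j : ℝ) / n) ^ (θ - 1) := by
  have hpos : ∀ n : ℕ, 0 < n → 0 < risingCoeff θ n / (n : ℝ) ^ (θ - 1) := fun n hn =>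
    div_pos (risingCoeff_pos hθ n) (Real.rpow_pos_of_pos (by exact_mod_cast hn) _)
  obtain ⟨c, C, hc, hC, hcC⟩ := exists_bounds_of_tendsto hpos
    (tendsto_risingCoeff_div_rpow hθ) (inv_pos.2 (Real.Gamma_pos_of_pos (by linarith)))
  -- With c and C bounding the coefficients divided by n ^ (θ - 1), a quotient of two coefficients
  -- differs from the quotient of powers by a factor between c / C and C / c.
  refine ⟨C / c, by positivity, fun n j hj => ?_⟩
  have hn : (0 : ℝ) < n := by exact_mod_cast (Nat.zero_le j).trans_lt hj
  have hnj : (0 : ℝ) < (n - j : ℕ) := by exact_mod_cast Nat.sub_pos_of_lt hj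
  have e : (1 - (j : ℝ) / n) = ((n - j : ℕ) : ℝ) / n := by
    rw [Nat.cast_sub hj.le]; field_simp
  obtain ⟨a1, a2⟩ := hcC n (by omega)
  obtain ⟨b1, b2⟩ := hcC (n - j) (by omega)
  have p1 := Real.rpow_pos_of_pos hn (θ - 1)
  have p2 := Real.rpow_pos_of_pos hnj (θ - 1)
  have q1 := risingCoeff_pos hθ n
  have q2 := risingCoeff_pos hθ (n - j)
  rw [le_div_iff₀ p1] at a1
  rw [le_div_iff₀ p2] at b1
  rw [div_le_iff₀ p1] at a2
  rw [div_le_iff₀ p2] at b2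
  rw [e, Real.div_rpow hnj.le hn.le]
  generalize ((n - j : ℕ) : ℝ) ^ (θ - 1) = x at *
  generalize (n : ℝ) ^ (θ - 1) = y at *
  generalize risingCoeff θ n = P at *
  generalize risingCoeff θ (n - j) = Q at *
  constructor
  · rw [div_mul_div_comm, div_le_div_iff₀ p1 (by positivity)]
    nlinarith [mul_le_mul b1 a2 q1.le q2.le]
  · rw [div_mul_div_comm, div_le_div_iff₀ q1 (by positivity)]
    nlinarith [mul_le_mul b2 a1 (by positivity) (by positivity)]

theorem tendsto_risingCoeff_ratio {θ : ℝ} (hθ : 1 ≤ θ) {m : ℕ → ℕ}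
    (hm : (fun n => (m n : ℝ)) =o[atTop] fun n => (n : ℝ)) :
    Tendsto (fun n => risingCoeff θ (n - m n) / risingCoeff θ n) atTop (𝓝 1) := by
  have hG : (Real.Gamma θ)⁻¹ ≠ 0 := (inv_pos.2 (Real.Gamma_pos_of_pos (by linarith))).ne'
  have h0 : Tendsto (fun n => (m n : ℝ) / n) atTop (𝓝 0) := hm.tendsto_div_nhds_zero
  -- This forces n - m n → ∞, so that the asymptotics apply to the numerator as well.
  have hle : ∀ᶠ n in atTop, 2 * m n ≤ n ∧ 0 < n := by
    filter_upwards [h0.eventually_lt_const (show (0 : ℝ) < 1 / 2 by norm_num),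
      eventually_gt_atTop 0] with n hn hn0
    have : (0 : ℝ) < n := by exact_mod_cast hn0
    rw [div_lt_iff₀ this] at hn
    refine ⟨?_, hn0⟩
    have : (2 * m n : ℝ) ≤ n := by linarith
    exact_mod_cast this
  have htop : Tendsto (fun n => n - m n) atTop atTop := by
    rw [tendsto_atTop]
    intro b
    filter_upwards [hle, eventually_ge_atTop (2 * b)] with n h1 h2
    omega
  have h1 := tendsto_risingCoeff_div_rpow hθ
  have h2 := ((h1.comp htop).div h1 hG)
  have h3 : Tendsto (fun n => (1 - (m n : ℝ) / n) ^ (θ - 1)) atTop (𝓝 1) := by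
    have := (h0.const_sub 1).rpow_const (p := θ - 1) (Or.inr (by linarith))
    simpa using this
  have h4 := h2.mul h3
  rw [div_self hG, mul_one] at h4
  refine h4.congr' ?_
  filter_upwards [hle] with n hn
  have hn0 : (0 : ℝ) < n := by exact_mod_cast hn.2
  have hnj : (0 : ℝ) < (n - m n : ℕ) := by
    have : 0 < n - m n := by omega
    exact_mod_cast this
  have e : (1 - (m n : ℝ) / n) = ((n - m n : ℕ) : ℝ) / n := by
    rw [Nat.cast_sub (by omega)]; field_simp
  have p1 := Real.rpow_pos_of_pos hn0 (θ - 1)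
  have p2 := Real.rpow_pos_of_pos hnj (θ - 1)
  have q1 := risingCoeff_pos hθ n
  simp only [Function.comp, Pi.div_apply]
  rw [e, Real.div_rpow hnj.le hn0.le]
  field_simp

/-! ### The method of factorial moments for the Poisson law -/

theorem hasSum_descFactorial_mul_pow_div_factorial (C : ℝ) (k : ℕ) :
    HasSum (fun l : ℕ => (l.descFactorial k : ℝ) * (C ^ l / l.factorial)) (C ^ k * Real.exp C) := by
  rw [← hasSum_nat_add_iff' k, Finset.sum_eq_zero, sub_zero]
  · have h := (NormedSpace.expSeries_div_hasSum_exp C).mul_left (C ^ k)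
    rw [← Real.exp_eq_exp_ℝ] at h
    refine h.congr_fun fun l => ?_
    have h1 := Nat.factorial_mul_descFactorial (Nat.le_add_left k l)
    rw [Nat.add_sub_cancel] at h1
    rw [← h1, pow_add]
    have h2 : (0 : ℝ) < l.factorial := by positivity
    have h3 : (0 : ℝ) < ((l + k).descFactorial k : ℝ) := by
      exact_mod_cast Nat.descFactorial_pos.2 (Nat.le_add_left k l)
    push_cast
    field_simp
  · intro l hl
    rw [Nat.descFactorial_of_lt (Finset.mem_range.1 hl), Nat.cast_zero, zero_mul]

theorem sum_neg_one_pow_mul_descFactorial {l n : ℕ} (m : ℕ) (hl : l ≤ n) :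
    ∑ k ∈ Finset.range (n + 1), (-1 : ℝ) ^ k * (l.descFactorial (m + k) : ℝ) /
      (m.factorial * k.factorial) = if l = m then 1 else 0 := by
  rcases lt_or_ge l m with hlm | hlm
  · rw [if_neg hlm.ne]
    refine Finset.sum_eq_zero fun k _ => ?_
    rw [Nat.descFactorial_of_lt (by omega), Nat.cast_zero, mul_zero, zero_div]
  · have h1 : ∀ k, (-1 : ℝ) ^ k * (l.descFactorial (m + k) : ℝ) / (m.factorial * k.factorial) =
        l.choose m * (((-1) ^ k * ((l - m).choose k : ℤ) : ℤ) : ℝ) := by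
      intro k
      have h2 := Nat.descFactorial_mul_descFactorial (n := l) (Nat.le_add_right m k)
      rw [Nat.add_sub_cancel_left, Nat.descFactorial_eq_factorial_mul_choose,
        Nat.descFactorial_eq_factorial_mul_choose] at h2
      rw [← h2]
      have h3 : (0 : ℝ) < m.factorial := by positivity
      have h4 : (0 : ℝ) < k.factorial := by positivity
      push_cast
      field_simp
    simp_rw [h1]
    rw [← Finset.mul_sum, ← Int.cast_sum]
    have h5 : ∑ k ∈ Finset.range (n + 1), (-1 : ℤ) ^ k * ((l - m).choose k : ℤ) =
        if l - m = 0 then 1 else 0 := by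
      rw [← Int.alternating_sum_range_choose]
      symm
      refine Finset.sum_subset (fun i hi => ?_) fun i _ hi => ?_
      · simp at hi ⊢; omega
      · rw [Nat.choose_eq_zero_of_lt (by simp at hi; omega), Nat.cast_zero, mul_zero]
    rw [h5]
    rcases eq_or_lt_of_le hlm with rfl | h
    · simp
    · rw [if_neg (by omega), if_neg (by omega)]
      simp

section Moments

variable {q : ℕ → ℕ → ℝ} {f : ℕ → ℕ → ℝ} {C μ : ℝ}

/-- Inclusion–exclusion: `sum_neg_one_pow_mul_descFactorial` recovers the indicator of l = m from
falling factorials of l. The series is finite because q n has bounded support. -/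
theorem eq_tsum_of_factorial_moments
    (hf : ∀ n k, ∑ l ∈ Finset.range (n + 1), (l.descFactorial k : ℝ) * q n l = f n k)
    (hq : ∀ n l, n < l → q n l = 0) (n m : ℕ) :
    q n m = ∑' k, (-1 : ℝ) ^ k * f n (m + k) / (m.factorial * k.factorial) := by
  rw [tsum_eq_sum (s := Finset.range (n + 1))]
  · simp_rw [← hf, Finset.mul_sum, Finset.sum_div]
    rw [Finset.sum_comm]
    have : ∀ l ∈ Finset.range (n + 1), ∑ k ∈ Finset.range (n + 1),
        (-1 : ℝ) ^ k * ((l.descFactorial (m + k) : ℝ) * q n l) / (m.factorial * k.factorial) =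
        if l = m then q n l else 0 := by
      intro l hl
      have := sum_neg_one_pow_mul_descFactorial m (Nat.le_of_lt_succ (Finset.mem_range.1 hl))
      rw [← boole_mul, ← this, Finset.sum_mul]
      refine Finset.sum_congr rfl fun k _ => by ring
    rw [Finset.sum_congr rfl this, Finset.sum_ite_eq']
    split_ifs with h
    · rfl
    · exact hq n m (by simp at h; omega)
  · intro k hk
    have : f n (m + k) = 0 := by
      rw [← hf]
      refine Finset.sum_eq_zero fun l hl => ?_
      rw [Nat.descFactorial_of_lt (by simp at hk hl; omega), Nat.cast_zero, zero_mul]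
    rw [this, mul_zero, zero_div]

theorem tendsto_poisson_of_tendsto_factorial_moments
    (hf : ∀ n k, ∑ l ∈ Finset.range (n + 1), (l.descFactorial k : ℝ) * q n l = f n k)
    (hq : ∀ n l, n < l → q n l = 0) (hfC : ∀ᶠ n in atTop, ∀ k, |f n k| ≤ C ^ k)
    (h : ∀ k, Tendsto (fun n => f n k) atTop (𝓝 (μ ^ k))) (m : ℕ) :
    Tendsto (fun n => q n m) atTop (𝓝 (Real.exp (-μ) * μ ^ m / m.factorial)) := by
  simp_rw [eq_tsum_of_factorial_moments hf hq]
  have hlim : ∑' k : ℕ, (-1 : ℝ) ^ k * μ ^ (m + k) / (m.factorial * k.factorial) =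
      Real.exp (-μ) * μ ^ m / m.factorial := by
    have h1 := (NormedSpace.expSeries_div_hasSum_exp (-μ)).mul_left (μ ^ m / m.factorial)
    rw [← Real.exp_eq_exp_ℝ] at h1
    rw [mul_comm (Real.exp _), ← div_mul_eq_mul_div, ← h1.tsum_eq]
    refine tsum_congr fun k => ?_
    rw [neg_pow, pow_add]
    ring
  rw [← hlim]
  refine tendsto_tsum_of_dominated_convergence
    (bound := fun k : ℕ => C ^ m / m.factorial * (C ^ k / k.factorial)) ?_ ?_ ?_
  · exact (Real.summable_pow_div_factorial C).mul_left _
  · intro k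
    exact ((h (m + k)).const_mul _).div_const _
  · filter_upwards [hfC] with n hn k
    rw [norm_div, norm_mul, norm_pow, norm_neg, norm_one, one_pow, one_mul, Real.norm_eq_abs,
      Real.norm_of_nonneg (by positivity), div_mul_div_comm, ← pow_add]
    exact div_le_div_of_nonneg_right (hn _) (by positivity)

/-- The term i = l of the l-th factorial moment is l! q n l, so q n l ≤ C ^ l / l!. This summable
bound permits passing to the limit under the sum defining each factorial moment. -/
theorem tendsto_factorial_moments_of_tendsto_poisson
    (hf : ∀ n k, ∑ l ∈ Finset.range (n + 1), (l.descFactorial k : ℝ) * q n l = f n k)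
    (hq : ∀ n l, n < l → q n l = 0) (hq0 : ∀ n l, 0 ≤ q n l)
    (hfC : ∀ᶠ n in atTop, ∀ k, f n k ≤ C ^ k)
    (h : ∀ m, Tendsto (fun n => q n m) atTop (𝓝 (Real.exp (-μ) * μ ^ m / m.factorial))) (k : ℕ) :
    Tendsto (fun n => f n k) atTop (𝓝 (μ ^ k)) := by
  have hs : ∀ n, f n k = ∑' l, (l.descFactorial k : ℝ) * q n l := by
    intro n
    rw [← hf, tsum_eq_sum]
    intro l hl
    rw [hq n l (by simp at hl; omega), mul_zero]
  have hlim : ∑' l : ℕ, (l.descFactorial k : ℝ) * (Real.exp (-μ) * μ ^ l / l.factorial) = μ ^ k := by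
    have h1 := (hasSum_descFactorial_mul_pow_div_factorial μ k).mul_left (Real.exp (-μ))
    rw [mul_left_comm, ← Real.exp_add, neg_add_cancel, Real.exp_zero, mul_one] at h1
    rw [← h1.tsum_eq]
    exact tsum_congr fun l => by ring
  simp_rw [hs]
  rw [← hlim]
  refine tendsto_tsum_of_dominated_convergence
    (hasSum_descFactorial_mul_pow_div_factorial C k).summable (fun l => (h l).const_mul _) ?_
  filter_upwards [hfC] with n hn l
  rw [Real.norm_of_nonneg (mul_nonneg (Nat.cast_nonneg _) (hq0 n l))]
  refine mul_le_mul_of_nonneg_left ?_ (Nat.cast_nonneg _)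
  rw [le_div_iff₀ (by positivity)]
  refine le_trans ?_ (hn l)
  rcases lt_or_ge n l with hnl | hnl
  · rw [hq n l hnl, zero_mul, ← hf]
    exact Finset.sum_nonneg fun i _ => mul_nonneg (Nat.cast_nonneg _) (hq0 n i)
  · rw [← hf, mul_comm, ← Nat.descFactorial_self l]
    exact Finset.single_le_sum (f := fun i : ℕ => (i.descFactorial l : ℝ) * q n i)
      (fun i _ => mul_nonneg (Nat.cast_nonneg _) (hq0 n i))
      (Finset.mem_range.2 (Nat.lt_succ_of_le hnl))

/-- Second moment method: a variance at most the mean `a` bounds `a` by `1 / q 0`. -/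
theorem mean_mul_mass_zero_le_one
    (hf : ∀ n k, ∑ l ∈ Finset.range (n + 1), (l.descFactorial k : ℝ) * q n l = f n k)
    (hq0 : ∀ n l, 0 ≤ q n l) (n : ℕ) (h0 : f n 0 = 1) (h2 : f n 2 ≤ f n 1 ^ 2) :
    f n 1 * q n 0 ≤ 1 := by
  have hvar : ∀ a : ℝ, ∑ l ∈ Finset.range (n + 1), ((l : ℝ) - a) ^ 2 * q n l =
      f n 2 + f n 1 - 2 * a * f n 1 + a ^ 2 * f n 0 := by
    intro a
    rw [← hf n 1, ← hf n 2]
    rw [← hf n 0, Finset.mul_sum, Finset.mul_sum, ← Finset.sum_add_distrib,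
      ← Finset.sum_sub_distrib, ← Finset.sum_add_distrib]
    refine Finset.sum_congr rfl fun l _ => ?_
    have : (l.descFactorial 2 : ℝ) = l * (l - 1) := by
      cases l with
      | zero => simp
      | succ l => simp [Nat.descFactorial_succ]; ring
    rw [this, Nat.descFactorial_one, Nat.descFactorial_zero]
    push_cast
    ring
  have hle : f n 1 ^ 2 * q n 0 ≤ ∑ l ∈ Finset.range (n + 1), ((l : ℝ) - f n 1) ^ 2 * q n l := by
    have := Finset.single_le_sum (f := fun l : ℕ => ((l : ℝ) - f n 1) ^ 2 * q n l)
      (fun i _ => mul_nonneg (sq_nonneg _) (hq0 n i))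
      (Finset.mem_range.2 (Nat.succ_pos n))
    simpa using this
  have h1 : 0 ≤ f n 1 := by
    rw [← hf]
    exact Finset.sum_nonneg fun i _ => mul_nonneg (Nat.cast_nonneg _) (hq0 n i)
  rw [hvar, h0] at hle
  rcases h1.eq_or_lt with h | h
  · rw [← h]; simp
  · refine le_of_mul_le_mul_left ?_ h
    -- Writing a = f n 1, the variance f n 2 + a - a ^ 2 is at most a, and its term l = 0 is a ^ 2 *
    -- q n 0; one factor a is cancelled.
    nlinarith

theorem poissonCDF_eq_sum (μ : ℝ≥0) (x : ℝ) : poissonCDF μ x =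
    ∑ l ∈ Finset.range ⌈x⌉₊, Real.exp (-μ) * (μ : ℝ) ^ l / l.factorial := by
  have : {k : ℕ | (k : ℝ) < x} = (Finset.range ⌈x⌉₊ : Set ℕ) := by
    ext k
    simp [Nat.lt_ceil]
  rw [poissonCDF, this, ← MeasureTheory.sum_measureReal_singleton]
  exact Finset.sum_congr rfl fun l _ => ProbabilityTheory.poissonMeasure_real_singleton μ l

/-- The limit is locally constant at the half-integers l + 1/2, and differences of consecutive
values there are the point masses. Conversely, each value of either distribution function is a
finite sum of masses. -/
theorem weakConv_poissonCDF_iff {F : ℕ → ℝ → ℝ} {μ : ℝ≥0}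
    (hF : ∀ n x, F n x = ∑ l ∈ Finset.range ⌈x⌉₊, q n l) : WeakConv F (poissonCDF μ) ↔
      ∀ l, Tendsto (fun n => q n l) atTop (𝓝 (Real.exp (-μ) * (μ : ℝ) ^ l / l.factorial)) := by
  constructor
  · intro h
    have hceil : ∀ (l : ℕ) (y : ℝ), l < y → y < l + 1 → ⌈y⌉₊ = l + 1 := by
      intro l y h1 h2
      rw [Nat.ceil_eq_iff (by omega)]
      push_cast
      exact ⟨by simpa using h1, h2.le⟩
    have hsum : ∀ k, Tendsto (fun n => ∑ l ∈ Finset.range k, q n l) atTop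
        (𝓝 (∑ l ∈ Finset.range k, Real.exp (-μ) * (μ : ℝ) ^ l / l.factorial)) := by
      intro k
      cases k with
      | zero => simp
      | succ l =>
        have hx := hceil l (l + 1 / 2) (by linarith) (by linarith)
        have hc : ContinuousAt (poissonCDF μ) (l + 1 / 2) := by
          refine ContinuousAt.congr (continuousAt_const (y := poissonCDF μ (l + 1 / 2))) ?_
          filter_upwards [Ioo_mem_nhds (show (l : ℝ) < l + 1 / 2 by linarith)
            (show (l : ℝ) + 1 / 2 < l + 1 by linarith)] with y hy
          rw [poissonCDF_eq_sum, poissonCDF_eq_sum, hx, hceil l y hy.1 hy.2]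
        have := h _ hc
        simp_rw [hF, poissonCDF_eq_sum, hx] at this
        exact this
    intro l
    have := (hsum (l + 1)).sub (hsum l)
    simpa only [Finset.sum_range_succ, add_sub_cancel_left] using this
  · intro h x _
    simp_rw [hF, poissonCDF_eq_sum]
    exact tendsto_finsetSum _ fun l _ => h l

end Moments

/-! ### Equivalence of moment convergence with the truncation condition -/

variable {θ : ℝ} {J : ℕ → Finset ℕ}

theorem cycleMass_nonneg (hθ : 1 ≤ θ) (J : Finset ℕ) (n l : ℕ) : 0 ≤ cycleMass θ J n l :=
  div_nonneg (Finset.sum_nonneg fun m _ => partitionWeight_nonneg (by linarith) m)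
    (risingCoeff_pos hθ n).le

theorem normMoment_ge (hθ : 1 ≤ θ) {J : Finset ℕ} (hJ : ∀ j ∈ J, 0 < j) (r : ℕ) {n k : ℕ}
    (hk : k * r ≤ n) : risingCoeff θ (n - k * r) / risingCoeff θ n *
      (∑ j ∈ J with j ≤ r, θ / (j : ℝ)) ^ k ≤ normMoment θ J n k := by
  rw [normMoment, div_mul_eq_mul_div]
  exact div_le_div_of_nonneg_right (le_factorialMoment hθ hJ r hk) (risingCoeff_pos hθ n).le

/-- A sequence `r = o(n)` along which a vanishing tail remains vanishing. -/
theorem exists_isLittleO_tendsto_zero {b : ℕ → ℕ → ℝ} (hb : ∀ n r, 0 ≤ b n r)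
    (h : ∀ k, 0 < k → Tendsto (fun n => b n (n / k)) atTop (𝓝 0)) :
    ∃ r : ℕ → ℕ, (fun n => (r n : ℝ)) =o[atTop] (fun n => (n : ℝ)) ∧
      Tendsto (fun n => b n (r n)) atTop (𝓝 0) := by
  classical
  -- Diagonal argument: κ n is the largest k ≤ n whose tail beyond n / k is at most 1 / k. The
  -- hypothesis at each fixed k forces κ → ∞, and r = n / κ n; where κ n = 0 the quotients are 0 by
  -- convention.
  let P : ℕ → ℕ → Prop := fun n k => b n (n / k) ≤ 1 / (k : ℝ)
  let κ : ℕ → ℕ := fun n => Nat.findGreatest (P n) n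
  have hκ : Tendsto κ atTop atTop := by
    rw [tendsto_atTop]
    intro K
    have hK : (0 : ℝ) < 1 / ((K + 1 : ℕ) : ℝ) := by positivity
    filter_upwards [(h (K + 1) K.succ_pos).eventually_le_const hK, eventually_ge_atTop (K + 1)]
      with n h1 h2
    exact (Nat.le_succ K).trans (Nat.le_findGreatest h2 h1)
  have hκR : Tendsto (fun n => 1 / (κ n : ℝ)) atTop (𝓝 0) :=
    (tendsto_const_div_atTop_nhds_zero_nat 1).comp hκ
  refine ⟨fun n => n / κ n, ?_, ?_⟩
  · rw [isLittleO_iff_tendsto']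
    · refine squeeze_zero (fun n => by positivity) (fun n => ?_) hκR
      refine div_le_of_le_mul₀ (Nat.cast_nonneg n) (by positivity) ?_
      rw [one_div_mul_eq_div]
      exact Nat.cast_div_le
    · filter_upwards [eventually_gt_atTop 0] with n hn h0
      simp only [Nat.cast_eq_zero] at h0
      omega
  · refine squeeze_zero' (Eventually.of_forall fun n => hb _ _) ?_ hκR
    filter_upwards [hκ.eventually_gt_atTop 0] with n hn
    exact Nat.findGreatest_of_ne_zero (P := P n) rfl hn.ne'

theorem tendsto_normMoment (hθ : 1 ≤ θ) {μ : ℝ} (hJ : ∀ n, J n ⊆ Finset.Icc 1 n) {r : ℕ → ℕ}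
    (hr : (fun n => (r n : ℝ)) =o[atTop] (fun n => (n : ℝ)))
    (h1 : Tendsto (fun n => ∑ j ∈ J n with j ≤ r n, θ / (j : ℝ)) atTop (𝓝 μ))
    (h2 : Tendsto (fun n => ∑ j ∈ J n with r n < j ∧ j < n,
      1 / (j : ℝ) * (1 - (j : ℝ) / (n : ℝ)) ^ (θ - 1)) atTop (𝓝 0)) :
    ∀ k, Tendsto (fun n => normMoment θ (J n) n k) atTop (𝓝 (μ ^ k)) := by
  obtain ⟨K, hK, hKb⟩ := exists_risingCoeff_ratio_bounds hθ
  have hJpos : ∀ n, ∀ j ∈ J n, 0 < j := fun n j hj => (Finset.mem_Icc.1 (hJ n hj)).1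
  -- An upper bound for the mean with limit μ. The last term covers the length j = n, which the tail
  -- sum excludes.
  let U : ℕ → ℝ := fun n => (∑ j ∈ J n with j ≤ r n, θ / (j : ℝ)) +
    θ * K * (∑ j ∈ J n with r n < j ∧ j < n,
      1 / (j : ℝ) * (1 - (j : ℝ) / (n : ℝ)) ^ (θ - 1)) + θ / n
  have hU : Tendsto U atTop (𝓝 μ) := by
    have := (h1.add (h2.const_mul (θ * K))).add (tendsto_const_div_atTop_nhds_zero_nat θ)
    simpa only [mul_zero, add_zero] using this
  have hle : ∀ n, ∑ j ∈ J n, lengthMean θ n j ≤ U n := by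
    intro n
    have hsplit : ∀ j ∈ J n, lengthMean θ n j ≤ (if j ≤ r n then θ / (j : ℝ) else 0) +
        θ * K * (if r n < j ∧ j < n then 1 / (j : ℝ) * (1 - (j : ℝ) / (n : ℝ)) ^ (θ - 1) else 0) +
        (if j = n then θ / (n : ℝ) else 0) := by
      intro j hj
      have hjn := (Finset.mem_Icc.1 (hJ n hj)).2
      have p1 : 0 ≤ θ / (j : ℝ) := by positivity
      have p2 : 0 ≤ θ / (n : ℝ) := by positivity
      rcases hjn.eq_or_lt with rfl | hlt
      · have := lengthMean_le hθ j j
        rw [if_neg (show ¬(r j < j ∧ j < j) by omega), if_pos rfl, mul_zero]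
        split_ifs <;> linarith
      · by_cases hjr : j ≤ r n
        · rw [if_pos hjr, if_neg (by omega), if_neg hlt.ne]
          simpa using lengthMean_le hθ n j
        · rw [if_neg hjr, if_pos ⟨by omega, hlt⟩, if_neg hlt.ne, lengthMean, if_pos hjn]
          have := mul_le_mul_of_nonneg_left (hKb n j hlt).2 p1
          refine this.trans_eq ?_
          ring
    refine (Finset.sum_le_sum hsplit).trans ?_
    rw [Finset.sum_add_distrib, Finset.sum_add_distrib, ← Finset.mul_sum, ← Finset.sum_filter,
      ← Finset.sum_filter, Finset.sum_ite_eq']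
    refine add_le_add_right ?_ _
    split_ifs
    · exact le_rfl
    · positivity
  have hS : ∀ n, 0 ≤ ∑ j ∈ J n, lengthMean θ n j :=
    fun n => Finset.sum_nonneg fun j _ => lengthMean_nonneg hθ n j
  have hupper : ∀ n k, normMoment θ (J n) n k ≤ U n ^ k := fun n k =>
    (normMoment_le_pow hθ (hJpos n) le_rfl k).trans (pow_le_pow_left₀ (hS n) (hle n) k)
  intro k
  have hkr : (fun n => ((k * r n : ℕ) : ℝ)) =o[atTop] (fun n => (n : ℝ)) := by
    simp_rw [Nat.cast_mul]
    exact hr.const_mul_left _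
  have hlow := (tendsto_risingCoeff_ratio hθ hkr).mul (h1.pow k)
  rw [one_mul] at hlow
  refine tendsto_of_tendsto_of_tendsto_of_le_of_le' hlow (hU.pow k) ?_
    (Eventually.of_forall fun n => hupper n k)
  filter_upwards [hkr.bound (show (0 : ℝ) < 1 by norm_num)] with n hn
  refine normMoment_ge hθ (hJpos n) (r n) ?_
  simp only [RCLike.norm_natCast, one_mul, Nat.cast_le] at hn
  exact hn

theorem exists_truncation (hθ : 1 ≤ θ) {μ : ℝ} (hJ : ∀ n, J n ⊆ Finset.Icc 1 n)
    (hM : ∀ k, Tendsto (fun n => normMoment θ (J n) n k) atTop (𝓝 (μ ^ k))) :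
    ∃ r : ℕ → ℕ, (fun n => (r n : ℝ)) =o[atTop] (fun n => (n : ℝ)) ∧
      Tendsto (fun n => ∑ j ∈ J n with j ≤ r n, θ / (j : ℝ)) atTop (𝓝 μ) ∧
      Tendsto (fun n => ∑ j ∈ J n with r n < j ∧ j < n,
        1 / (j : ℝ) * (1 - (j : ℝ) / (n : ℝ)) ^ (θ - 1)) atTop (𝓝 0) := by
  obtain ⟨K, hK, hKb⟩ := exists_risingCoeff_ratio_bounds hθ
  have hJpos : ∀ n, ∀ j ∈ J n, 0 < j := fun n j hj => (Finset.mem_Icc.1 (hJ n hj)).1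
  have hθ0 : 0 < θ := by linarith
  have ha : Tendsto (fun n => ∑ j ∈ J n, lengthMean θ n j) atTop (𝓝 μ) := by
    have := hM 1
    simp_rw [fun n => normMoment_one hθ (hJpos n) n, pow_one] at this
    exact this
  have hb0 : ∀ n r, 0 ≤ ∑ j ∈ J n with r < j, lengthMean θ n j := fun n r =>
    Finset.sum_nonneg fun j _ => lengthMean_nonneg hθ n j
  obtain ⟨r, hr, hbr⟩ := exists_isLittleO_tendsto_zero hb0 fun k hk => by
    have h1 : Tendsto (fun n => (∑ j ∈ J n with n / k < j, lengthMean θ n j) ^ k) atTop (𝓝 0) := by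
      have h2 := (ha.pow k).sub (hM k)
      rw [sub_self] at h2
      refine squeeze_zero (fun n => pow_nonneg (hb0 n _) k) (fun n => ?_) h2
      have h3 : n < k * (n / k + 1) := by
        rw [mul_comm]
        exact Nat.lt_mul_of_div_lt (Nat.lt_succ_self _) hk
      have := normMoment_le_pow_sub_pow hθ (hJpos n) (n / k) le_rfl h3
      linarith
    -- Taking k-th roots turns b ^ k → 0 into b → 0.
    have h4 := h1.rpow_const (p := (k : ℝ)⁻¹) (Or.inr (by positivity))
    rw [Real.zero_rpow (by positivity)] at h4
    exact h4.congr fun n => Real.pow_rpow_inv_natCast (hb0 n _) hk.ne'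
  have hsmall : Tendsto (fun n => ∑ j ∈ J n with j ≤ r n, lengthMean θ n j) atTop (𝓝 μ) := by
    have := ha.sub hbr
    rw [sub_zero] at this
    refine this.congr fun n => ?_
    rw [sub_eq_iff_eq_add, ← Finset.sum_filter_add_sum_filter_not _ (fun j => j ≤ r n)]
    simp_rw [not_le]
  refine ⟨r, hr, ?_, ?_⟩
  -- For j ≤ r the mean number of j-cycles lies between θ / j times the coefficient ratio at shift
  -- r, which tends to 1, and θ / j itself.
  · have hR := tendsto_risingCoeff_ratio hθ hr
    have hupp := hsmall.div hR one_ne_zero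
    rw [div_one] at hupp
    refine tendsto_of_tendsto_of_tendsto_of_le_of_le' hsmall hupp
      (Eventually.of_forall fun n => Finset.sum_le_sum fun j _ => lengthMean_le hθ n j) ?_
    refine Eventually.of_forall fun n => ?_
    have p1 := risingCoeff_pos hθ n
    have p2 := risingCoeff_pos hθ (n - r n)
    simp only [Pi.div_apply]
    rw [le_div_iff₀ (div_pos p2 p1), Finset.sum_mul]
    refine Finset.sum_le_sum fun j hj => ?_
    obtain ⟨hj, hjr⟩ := Finset.mem_filter.1 hj
    rw [lengthMean, if_pos (Finset.mem_Icc.1 (hJ n hj)).2]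
    refine mul_le_mul_of_nonneg_left ?_ (by positivity)
    exact div_le_div_of_nonneg_right (risingCoeff_monotone hθ (by omega)) p1.le
  · have hlim := hbr.const_mul (K / θ)
    rw [mul_zero] at hlim
    have hpow : ∀ n j : ℕ, j < n → 0 ≤ (1 - (j : ℝ) / n) ^ (θ - 1) := by
      intro n j hj
      refine Real.rpow_nonneg (sub_nonneg.2 (div_le_one_of_le₀ ?_ (Nat.cast_nonneg n))) _
      exact_mod_cast hj.le
    refine squeeze_zero (fun n => Finset.sum_nonneg fun j hj => ?_) (fun n => ?_) hlim
    · exact mul_nonneg (by positivity) (hpow n j (Finset.mem_filter.1 hj).2.2)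
    · rw [Finset.mul_sum]
      calc _ ≤ ∑ j ∈ J n with r n < j ∧ j < n, K / θ * lengthMean θ n j := by
            refine Finset.sum_le_sum fun j hj => ?_
            have hjn := (Finset.mem_filter.1 hj).2.2
            have h1 := mul_le_mul_of_nonneg_left (hKb n j hjn).1
              (show (0 : ℝ) ≤ 1 / j by positivity)
            rw [lengthMean, if_pos hjn.le]
            refine h1.trans_eq ?_
            field_simp
        _ ≤ _ := by
            refine Finset.sum_le_sum_of_subset_of_nonneg (fun j hj => ?_) fun j _ _ => ?_
            · obtain ⟨h1, h2⟩ := Finset.mem_filter.1 hj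
              exact Finset.mem_filter.2 ⟨h1, h2.1⟩
            · have := lengthMean_nonneg hθ n j
              positivity

theorem tendsto_cycleMass_iff (hθ : 1 ≤ θ) {μ : ℝ} (hJ : ∀ n, J n ⊆ Finset.Icc 1 n) :
    (∀ l, Tendsto (fun n => cycleMass θ (J n) n l) atTop
      (𝓝 (Real.exp (-μ) * μ ^ l / l.factorial))) ↔
    (∀ k, Tendsto (fun n => normMoment θ (J n) n k) atTop (𝓝 (μ ^ k))) := by
  have hJpos : ∀ n, ∀ j ∈ J n, 0 < j := fun n j hj => (Finset.mem_Icc.1 (hJ n hj)).1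
  have hf : ∀ n k, ∑ l ∈ Finset.range (n + 1), (l.descFactorial k : ℝ) * cycleMass θ (J n) n l =
      normMoment θ (J n) n k := fun n k => sum_descFactorial_mul_cycleMass θ (J n) n k
  have hq : ∀ n l, n < l → cycleMass θ (J n) n l = 0 := fun n l h => cycleMass_eq_zero h
  have hq0 : ∀ n l, 0 ≤ cycleMass θ (J n) n l := fun n l => cycleMass_nonneg hθ (J n) n l
  have hpow : ∀ n k, normMoment θ (J n) n k ≤ normMoment θ (J n) n 1 ^ k := fun n k => by
    rw [normMoment_one hθ (hJpos n)]
    exact normMoment_le_pow hθ (hJpos n) le_rfl k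
  have hbdd : ∀ C : ℝ, (∀ᶠ n in atTop, normMoment θ (J n) n 1 ≤ C) →
      ∀ᶠ n in atTop, ∀ k, normMoment θ (J n) n k ≤ C ^ k := fun C h => by
    filter_upwards [h] with n hn k
    exact (hpow n k).trans (pow_le_pow_left₀ (normMoment_nonneg hθ _ _ _) hn k)
  constructor
  · intro h
    have h0 : Tendsto (fun n => (cycleMass θ (J n) n 0)⁻¹) atTop (𝓝 (Real.exp (-μ))⁻¹) := by
      have := h 0
      simp only [pow_zero, mul_one, Nat.factorial_zero, Nat.cast_one, div_one] at this
      exact this.inv₀ (Real.exp_ne_zero _)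
    -- The mean is at most the reciprocal of the mass at 0, which tends to exp(μ); adding 1 gives an
    -- eventual bound.
    refine tendsto_factorial_moments_of_tendsto_poisson hf hq hq0
      (hbdd ((Real.exp (-μ))⁻¹ + 1) ?_) h
    filter_upwards [h0.eventually_le_const (lt_add_one _),
      h0.eventually_const_lt (inv_pos.2 (Real.exp_pos (-μ)))] with n hn hpos
    refine le_trans ?_ hn
    rw [← one_div, le_div_iff₀ (inv_pos.1 hpos)]
    exact mean_mul_mass_zero_le_one hf hq0 n (normMoment_zero hθ _ _) (hpow n 2)
  · intro h l
    have h1 := h 1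
    rw [pow_one] at h1
    refine tendsto_poisson_of_tendsto_factorial_moments hf hq (C := μ + 1) ?_ h l
    filter_upwards [hbdd _ (h1.eventually_le_const (lt_add_one μ))] with n hn k
    rw [abs_of_nonneg (normMoment_nonneg hθ _ _ _)]
    exact hn k

end Ewens

theorem corollary4 (θ : ℝ) (hθ : 1 ≤ θ) (μ : ℝ≥0) (hμ : 0 < μ)
    (J : ℕ → Finset ℕ) (hJ : ∀ n, J n ⊆ Finset.Icc 1 n) :
    Ewens.WeakConv (fun n => Ewens.cycleCDF θ n (J n)) (Ewens.poissonCDF μ) ↔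
      ∃ r : ℕ → ℕ, (fun n => (r n : ℝ)) =o[atTop] (fun n => (n : ℝ)) ∧
        Tendsto (fun n => ∑ j ∈ J n with j ≤ r n, θ / (j : ℝ)) atTop (𝓝 (μ : ℝ)) ∧
        Tendsto (fun n => ∑ j ∈ J n with r n < j ∧ j < n,
          1 / (j : ℝ) * (1 - (j : ℝ) / (n : ℝ)) ^ (θ - 1)) atTop (𝓝 0) := by
  rw [Ewens.weakConv_poissonCDF_iff fun n x => Ewens.cycleCDF_eq_sum θ (J n) n x,
    Ewens.tendsto_cycleMass_iff hθ hJ]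
  exact ⟨Ewens.exists_truncation hθ hJ,
    fun ⟨_, hr, h1, h2⟩ => Ewens.tendsto_normMoment hθ hJ hr h1 h2⟩
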